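/- Let $A\in\mathbb R^{n\times n}$, $B\in\mathbb R^{n\times m}$, $x_0\in\mathbb R^n$ and $\Delta t>0$. Put $\varphi(t\mid u)=e^{At}x_0+\int_0^t e^{A(t-s)}Bu(s)\,ds$ and $$A_d=e^{A\Delta t},\qquad B_d=\int_0^{\Delta t}e^{As}B\,ds .$$ For a matrix $F$ and a matrix $W$ with equally many rows let $\mathcal K_r(F,W)$ be the span of the columns of $W,FW,\dots,F^{r-1}W$. Define the reachable subspaces $\mathcal R^{ct}=\mathcal K_n(A,B)$, $\mathcal R^{dt}=\mathcal K_n(A_d,B_d)$ and the visible subspaces $V_{ct}(x_0)=\mathcal K_n(A,[x_0\ B])$, $V_{dt}(x_0)=\mathcal K_n(A_d,[x_0\ B_d])$. Let $\sigma(A)\subset\mathbb C$ be the set of complex eigenvalues of $A$ and $\sigma_r(A,B)$ the set of complex eigenvalues of the restriction $A|_{\mathcal R^{ct}}$. Call $\Delta t$ non-pathological on $S\subseteq\mathbb C$ if $\lambda\mapsto e^{\lambda\Delta t}$ is injective on $S$. Then: 1. (Exact discretization.) For every input sequence $(u[j])_{j\ge0}$ in $\mathbb R^m$ and the zero-order-hold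 input $u(t)=u[j]$, $t\in[j\Delta t,(j+1)\Delta t)$, the samples $x[j]=\varphi(j\Delta t\mid u)$ satisfy $x[0]=x_0$ and $x[j+1]=A_dx[j]+B_du[j]$. 2. (Reachable subspace.) If $\Delta t$ is non-pathological on $\sigma_r(A,B)$, then $\mathcal R^{dt}=\mathcal R^{ct}$. 3. (Visible subspace.) If $\Delta t$ is non-pathological on $\sigma(A)$, then $\mathcal R^{dt}=\mathcal R^{ct}$ and $V_{dt}(x_0)=V_{ct}(x_0)$. 4. (Informativeness.) Let $\Delta t$ be non-pathological on $\sigma(A)$, let $k=\dim V_{ct}(x_0)$, let the columns of $P\in\mathbb R^{n\times k}$ form an orthonormal basis of $V_{ct}(x_0)$, and put $A_V=P^\top AP$, $B_V=P^\top B$, $A_{d,V}=e^{A_V\Delta t}$, $B_{d,V}=\int_0^{\Delta t}e^{A_Vs}B_V\,ds$. Then $\mathcal K_k(A_{d,V},[P^\top x_0\ B_{d,V}])=\mathbb R^k$. For every input sequence, with $x[j]$ as in 1, the coordinates $\xi[j]=P^\top x[j]$ satisfy $\xi[j+1]=A_{d,V}\xi[j]+B_{d,V}u[j]$. Moreover,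 if $N\ge k+1$ and the input Hankel matrix of order $k+1$, $$\begin{bmatrix}u[0]&u[1]&\cdots&u[N-k-1]\\ u[1]&u[2]&\cdots&u[N-k]\\ \vdots&\vdots&&\vdots\\ u[k]&u[k+1]&\cdots&u[N-1]\end{bmatrix},$$ has full row rank $(k+1)m$, then the discrete joint-regressor Gramian $\mathcal G_d=\sum_{j=0}^{N-1}z[j]z[j]^\top$, with $z[j]=[\xi[j]^\top,\ u[j]^\top]^\top\in\mathbb R^{k+m}$, is positive definite. -/

import Mathlib

noncomputable section

namespace ZOH

/-- The Krylov span `𝒦_r(A, W) = span {W, A W, …, A^(r-1) W}`, spanned by the columns of the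
matrices `A^i W` with `i < r`. -/
def krylov {K ι κ : Type*} [Field K] [Fintype ι] [DecidableEq ι]
    (r : ℕ) (A : Matrix ι ι K) (W : Matrix ι κ K) : Submodule K (ι → K) :=
  Submodule.span K {v | ∃ i < r, ∃ c : κ, v = (A ^ i * W).col c}

/-- The reachable subspace `span {A^i B}` of an `n`-dimensional pair `(A, B)`. -/
def reachable {K : Type*} [Field K] {n m : ℕ}
    (A : Matrix (Fin n) (Fin n) K) (B : Matrix (Fin n) (Fin m) K) : Submodule K (Fin n → K) :=
  krylov n A B

/-- The column-wise stacked matrix `[x₀ B]`. -/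
def augment {n m : ℕ} (x₀ : Fin n → ℝ) (B : Matrix (Fin n) (Fin m) ℝ) :
    Matrix (Fin n) (Unit ⊕ Fin m) ℝ :=
  Matrix.fromCols (Matrix.replicateCol Unit x₀) B

/-- The visible subspace `V(x₀) = 𝒦_n(A, [x₀ B])`. -/
def visible {n m : ℕ} (A : Matrix (Fin n) (Fin n) ℝ) (B : Matrix (Fin n) (Fin m) ℝ)
    (x₀ : Fin n → ℝ) : Submodule ℝ (Fin n → ℝ) :=
  krylov n A (augment x₀ B)

/-- A real matrix viewed as a complex one. -/
def complexify {ι κ : Type*} (M : Matrix ι κ ℝ) : Matrix ι κ ℂ :=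
  M.map (algebraMap ℝ ℂ)

/-- The complex eigenvalues of `A`. -/
def fullSpectrum {n : ℕ} (A : Matrix (Fin n) (Fin n) ℝ) : Set ℂ :=
  spectrum ℂ (complexify A)

/-- The reachable spectrum `σ_r(A, B)`: the complex eigenvalues of the restriction of `A` to the
reachable subspace, i.e. those with an eigenvector in the complexified reachable subspace. -/
def reachableSpectrum {n m : ℕ} (A : Matrix (Fin n) (Fin n) ℝ) (B : Matrix (Fin n) (Fin m) ℝ) :
    Set ℂ :=
  {z | ∃ v ∈ reachable (complexify A) (complexify B),
    v ≠ 0 ∧ (complexify A).mulVec v = z • v}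

/-- The sampling step `Δ` is non-pathological on `S`: distinct `z ∈ S` have distinct
`exp (z Δ)`. -/
def NonPathologicalOn (S : Set ℂ) (Δ : ℝ) : Prop :=
  Set.InjOn (fun z : ℂ => Complex.exp (z * (Δ : ℂ))) S

/-- `A_d = e^{A Δ}`. -/
def zohA {n : ℕ} (A : Matrix (Fin n) (Fin n) ℝ) (Δ : ℝ) : Matrix (Fin n) (Fin n) ℝ :=
  NormedSpace.exp (Δ • A)

/-- `B_d = ∫_0^Δ e^{A s} B ds`, the integral being taken entrywise. -/
def zohB {n m : ℕ} (A : Matrix (Fin n) (Fin n) ℝ) (B : Matrix (Fin n) (Fin m) ℝ) (Δ : ℝ) :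
    Matrix (Fin n) (Fin m) ℝ :=
  Matrix.of fun i j => ∫ s in (0 : ℝ)..Δ, (NormedSpace.exp (s • A) * B) i j

/-- The continuous-time response
`φ(t | A, B, x₀, u) = e^{A t} x₀ + ∫_0^t e^{A (t - s)} B u(s) ds`. -/
def response {n m : ℕ} (A : Matrix (Fin n) (Fin n) ℝ) (B : Matrix (Fin n) (Fin m) ℝ)
    (x₀ : Fin n → ℝ) (u : ℝ → Fin m → ℝ) (t : ℝ) : Fin n → ℝ :=
  (NormedSpace.exp (t • A)).mulVec x₀ +
    fun i => ∫ s in (0 : ℝ)..t, (NormedSpace.exp ((t - s) • A) * B).mulVec (u s) i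

/-- The zero-order-hold input: `u(t) = u[j]` for `t ∈ [j Δ, (j + 1) Δ)`. -/
def hold {m : ℕ} (Δ : ℝ) (u : ℕ → Fin m → ℝ) (t : ℝ) : Fin m → ℝ :=
  u ⌊t / Δ⌋₊

/-- The discrete-time state: `x[0] = x₀`, `x[j + 1] = F x[j] + G u[j]`. -/
def dtState {n m : ℕ} (F : Matrix (Fin n) (Fin n) ℝ) (G : Matrix (Fin n) (Fin m) ℝ)
    (x₀ : Fin n → ℝ) (u : ℕ → Fin m → ℝ) : ℕ → Fin n → ℝ
  | 0 => x₀
  | j + 1 => F.mulVec (dtState F G x₀ u j) + G.mulVec (u j)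

/-- The Hankel matrix of order `r` of `u[0], …, u[N-1]`: `r` block rows of height `m`,
`N - r + 1` columns, and `u[i + j]` as block `(i, j)`. -/
def hankel {m : ℕ} (r N : ℕ) (u : ℕ → Fin m → ℝ) :
    Matrix (Fin r × Fin m) (Fin (N + 1 - r)) ℝ :=
  Matrix.of fun p j => u ((p.1 : ℕ) + (j : ℕ)) p.2

/-- `u[0], …, u[N-1]` is persistently exciting of order `r`: its Hankel matrix of order `r` exists
(`r ≤ N`) and has full row rank `r m`. For `m ≥ 1` and `r ≥ 1` the rank condition alone forces
`r ≤ N`. -/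
def PersistentlyExciting {m : ℕ} (r N : ℕ) (u : ℕ → Fin m → ℝ) : Prop :=
  r ≤ N ∧ (hankel r N u).rank = r * m

/-- The columns of `P` form an orthonormal basis of `V`. -/
def IsOrthonormalBasisOf {n k : ℕ} (P : Matrix (Fin n) (Fin k) ℝ)
    (V : Submodule ℝ (Fin n → ℝ)) : Prop :=
  P.transpose * P = 1 ∧ Submodule.span ℝ (Set.range P.col) = V

/-- The discrete Gramian `∑_{j < N} z[j] z[j]ᵀ` of the joint regressor `z[j] = (ξ[j], u[j])`. -/
def gramian {k m : ℕ} (ξ : ℕ → Fin k → ℝ) (u : ℕ → Fin m → ℝ) (N : ℕ) :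
    Matrix (Fin k ⊕ Fin m) (Fin k ⊕ Fin m) ℝ :=
  ∑ j ∈ Finset.range N, Matrix.vecMulVec (Sum.elim (ξ j) (u j)) (Sum.elim (ξ j) (u j))

end ZOH

end

/-! Write `Ψ = ∫_0^Δ e^{sA} ds`, so that `B_d = Ψ B`. Preservation of Krylov spaces rests on two
facts about a step that is non-pathological on the spectrum: `A` is a polynomial in `e^{ΔA}`
(`exists_aeval_exp_smul_eq`), and `Ψ` is invertible (`isUnit_expIntegral_real`). By the first, an
`e^{ΔA}`-invariant subspace is invariant under `A` and `Ψ`. By the second, replacing some columns of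
`W` by their images under `Ψ` still gives a generating family if `W` generates the whole space
(`krylov_exp_eq_top`).

The general case reduces to this one by restricting `A` to the Krylov space in coordinates `P`, `Q`
with `Q * P = 1`. The restriction only has eigenvalues with eigenvectors in the complexified Krylov
space, so the reachable spectrum suffices for the reachable subspace.

Exactness comes from splitting the convolution integral at the sampling instants. For the Gramian, a
vector in its kernel gives a linear relation between state and input at every time. Combining `k +
1` consecutive relations with the coefficients of the characteristic polynomial eliminates the state
by Cayley–Hamilton; persistent excitation kills the remaining input weights, and the visible pair
being controllable does the rest (`eq_zero_of_dotProduct_eq_zero`). -/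

namespace ZOH

open NormedSpace

/-! ### The integral of the exponential in a Banach algebra. -/

section BanachAlgebra

variable {𝔸 : Type*} [NormedRing 𝔸] [NormedAlgebra ℝ 𝔸] [CompleteSpace 𝔸]

/-- The integral `∫_0^t e^{s a} ds` in a Banach algebra. -/
noncomputable def expIntegral (a : 𝔸) (t : ℝ) : 𝔸 := ∫ s in (0 : ℝ)..t, exp (s • a)

theorem continuous_exp_smul (a : 𝔸) : Continuous fun s : ℝ => exp (s • a) :=
  continuous_iff_continuousAt.2 fun s => (hasDerivAt_exp_smul_const a s).continuousAt

theorem intervalIntegrable_exp_smul (a : 𝔸) (s t : ℝ) :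
    IntervalIntegrable (fun r : ℝ => exp (r • a)) MeasureTheory.volume s t :=
  (continuous_exp_smul a).intervalIntegrable s t

theorem expIntegral_mul_self (a : 𝔸) (t : ℝ) :
    expIntegral a t * a = exp (t • a) - 1 := by
  have h := intervalIntegral.integral_eq_sub_of_hasDerivAt
    (f := fun s : ℝ => exp (s • a)) (f' := fun s => exp (s • a) * a) (a := 0) (b := t)
    (fun s _ => hasDerivAt_exp_smul_const a s)
    (((continuous_exp_smul a).mul continuous_const).intervalIntegrable 0 t)
  have h2 := ((ContinuousLinearMap.mul ℝ 𝔸).flip a).intervalIntegral_comp_comm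
    (intervalIntegrable_exp_smul a 0 t)
  simp only [ContinuousLinearMap.flip_apply, ContinuousLinearMap.mul_apply'] at h2
  rw [expIntegral, ← h2, h]
  simp

theorem clm_expIntegral {F : Type*} [NormedAddCommGroup F] [NormedSpace ℝ F] [CompleteSpace F]
    (f : 𝔸 →L[ℝ] F) (a : 𝔸) (t : ℝ) :
    f (expIntegral a t) = ∫ s in (0 : ℝ)..t, f (exp (s • a)) :=
  (f.intervalIntegral_comp_comm (intervalIntegrable_exp_smul a 0 t)).symm

theorem expIntegral_zero (t : ℝ) : expIntegral (0 : 𝔸) t = t • 1 := by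
  simp [expIntegral]

variable [FiniteDimensional ℝ 𝔸]

theorem exp_mem_of_forall_pow_mem {S : Submodule ℝ 𝔸} {a : 𝔸} (h : ∀ i : ℕ, a ^ i ∈ S) :
    exp a ∈ S :=
  S.closed_of_finiteDimensional.mem_of_tendsto (exp_series_hasSum_exp' (𝕂 := ℝ) a)
    (Filter.Eventually.of_forall fun _ => S.sum_mem fun i _ => S.smul_mem _ (h i))

/-- Otherwise a linear functional vanishing on `S` would separate the integral from `S`; but it
passes under the integral sign and kills every `exp (s • a)`. -/
theorem expIntegral_mem_of_forall_pow_mem {S : Submodule ℝ 𝔸} {a : 𝔸} (h : ∀ i : ℕ, a ^ i ∈ S)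
    (t : ℝ) : expIntegral a t ∈ S := by
  by_contra hn
  obtain ⟨f, hf, hS⟩ := Submodule.exists_le_ker_of_notMem hn
  apply hf
  have := clm_expIntegral f.toContinuousLinearMap a t
  simp only [LinearMap.coe_toContinuousLinearMap'] at this
  rw [this]
  have h0 : ∀ s : ℝ, f (exp (s • a)) = 0 := fun s => hS <| exp_mem_of_forall_pow_mem fun i => by
    rw [smul_pow]; exact S.smul_mem _ (h i)
  simp [h0]

theorem commute_expIntegral {a b : 𝔸} (hb : Commute b a) (t : ℝ) :
    Commute b (expIntegral a t) :=
  (Subalgebra.mem_centralizer_iff ℝ).1 (expIntegral_mem_of_forall_pow_mem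
    (S := (Subalgebra.centralizer ℝ {b}).toSubmodule) (fun i => by
      simpa [Subalgebra.mem_centralizer_iff] using (hb.pow_right i).eq) t) b rfl

end BanachAlgebra

/-! ### Intertwining relations pass to exponentials and their integrals. -/

section Intertwine

open scoped Matrix.Norms.Operator

variable {𝕜 ι κ : Type*} [RCLike 𝕜] [Fintype ι] [DecidableEq ι] [Fintype κ] [DecidableEq κ]

theorem pow_intertwine {R : Type*} [Semiring R] {M : Matrix ι ι R} {N : Matrix κ κ R}
    {P : Matrix ι κ R} (h : M * P = P * N) (i : ℕ) : M ^ i * P = P * N ^ i := by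
  induction i with
  | zero => simp
  | succ i ih => rw [pow_succ, Matrix.mul_assoc, h, ← Matrix.mul_assoc, ih, Matrix.mul_assoc,
      ← pow_succ]

theorem exp_intertwine {M : Matrix ι ι 𝕜} {N : Matrix κ κ 𝕜}
    {P : Matrix ι κ 𝕜} (h : M * P = P * N) : exp M * P = P * exp N := by
  have h1 := (exp_series_hasSum_exp' (𝕂 := ℝ) M).mapL (LinearMap.toContinuousLinearMap
    ((mulRightLinearMap ι ℝ P) : Matrix ι ι 𝕜 →ₗ[ℝ] Matrix ι κ 𝕜))
  have h2 := (exp_series_hasSum_exp' (𝕂 := ℝ) N).mapL (LinearMap.toContinuousLinearMap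
    ((mulLeftLinearMap κ ℝ P) : Matrix κ κ 𝕜 →ₗ[ℝ] Matrix ι κ 𝕜))
  simp only [LinearMap.coe_toContinuousLinearMap', mulRightLinearMap_apply,
    mulLeftLinearMap_apply] at h1 h2
  simp only [Matrix.smul_mul, pow_intertwine h, ← Matrix.mul_smul] at h1
  exact h1.unique h2

theorem expIntegral_intertwine {M : Matrix ι ι 𝕜} {N : Matrix κ κ 𝕜}
    {P : Matrix ι κ 𝕜} (h : M * P = P * N) (t : ℝ) :
    expIntegral M t * P = P * expIntegral N t := by
  have h1 := clm_expIntegral (LinearMap.toContinuousLinearMap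
    ((mulRightLinearMap ι ℝ P) : Matrix ι ι 𝕜 →ₗ[ℝ] Matrix ι κ 𝕜)) M t
  have h2 := clm_expIntegral (LinearMap.toContinuousLinearMap
    ((mulLeftLinearMap κ ℝ P) : Matrix κ κ 𝕜 →ₗ[ℝ] Matrix ι κ 𝕜)) N t
  simp only [LinearMap.coe_toContinuousLinearMap', mulRightLinearMap_apply,
    mulLeftLinearMap_apply] at h1 h2
  rw [h1, h2]
  congr 1
  ext s : 1
  exact exp_intertwine (by rw [Matrix.smul_mul, Matrix.mul_smul, h])

end Intertwine

/-! ### Invertibility of the integrated exponential over `ℂ`. -/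

section Complex

open scoped Matrix.Norms.Operator

variable {ι : Type*} [Fintype ι] [DecidableEq ι]

/-- The kernel of `Q` is nonzero and `M`-invariant, so over `ℂ` the restriction of `M` to it has an
eigenvector. -/
theorem exists_eigenvector_of_commute {M Q : Matrix ι ι ℂ} (h : Commute M Q) (hQ : ¬ IsUnit Q) :
    ∃ (z : ℂ) (v : ι → ℂ), v ≠ 0 ∧ M.mulVec v = z • v ∧ Q.mulVec v = 0 := by
  have hinv : ∀ x ∈ LinearMap.ker Q.toLin', M.toLin' x ∈ LinearMap.ker Q.toLin' := by
    intro x hx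
    simp only [LinearMap.mem_ker, Matrix.toLin'_apply] at hx ⊢
    rw [Matrix.mulVec_mulVec, ← h.eq, ← Matrix.mulVec_mulVec, hx, Matrix.mulVec_zero]
  have : Nontrivial (LinearMap.ker Q.toLin') := by
    rw [Submodule.nontrivial_iff_ne_bot]
    intro hb
    apply hQ
    rw [← Matrix.mulVec_injective_iff_isUnit]
    exact LinearMap.ker_eq_bot.1 hb
  obtain ⟨z, hz⟩ := Module.End.exists_eigenvalue (M.toLin'.restrict hinv)
  obtain ⟨v, hv⟩ := hz.exists_hasEigenvector
  refine ⟨z, v, by simpa using hv.2, ?_, v.2⟩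
  have := congrArg Subtype.val hv.apply_eq_smul
  simpa using this

theorem mem_spectrum_of_mulVec_eq {M : Matrix ι ι ℂ} {z : ℂ} {v : ι → ℂ} (hv : v ≠ 0)
    (h : M.mulVec v = z • v) : z ∈ spectrum ℂ M := by
  rw [← Matrix.spectrum_toLin', ← Module.End.hasEigenvalue_iff_mem_spectrum]
  exact Module.End.hasEigenvalue_of_hasEigenvector
    (Module.End.hasEigenvector_iff.2 ⟨Module.End.mem_eigenspace_iff.2 (by simpa using h), hv⟩)

/-- A singular integral kills some eigenvector of `M`, with eigenvalue `z`, so `∫_0^t e^{sz} ds =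
0`. This forces `e^{zt} = 1`, hence `z = 0`, and then the integral is `t ≠ 0`. -/
theorem isUnit_expIntegral {M : Matrix ι ι ℂ} {t : ℝ} (ht : t ≠ 0)
    (h : ∀ z ∈ spectrum ℂ M, Complex.exp (z * t) = 1 → z = 0) : IsUnit (expIntegral M t) := by
  by_contra hu
  obtain ⟨z, v, hv, hM, hQ⟩ := exists_eigenvector_of_commute
    (commute_expIntegral (Commute.refl M) t) hu
  have hs := mem_spectrum_of_mulVec_eq hv hM
  set V : Matrix ι Unit ℂ := Matrix.replicateCol Unit v
  -- The eigenvector equation is an intertwining of `M` with the `1 × 1` matrix `z`, which reduces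
  -- the integral to the scalar one.
  set N : Matrix Unit Unit ℂ := Matrix.diagonal fun _ => z with hN
  have hV : M * V = V * N := by
    ext i j
    have := congrFun hM i
    simpa [V, N, Matrix.mul_apply, Matrix.mulVec, dotProduct, mul_comm z] using this
  have h1 : V * expIntegral N t = 0 := by
    rw [← expIntegral_intertwine hV t]
    ext i j
    simpa [V, Matrix.mul_apply, Matrix.mulVec, dotProduct] using congrFun hQ i
  obtain ⟨i, hi⟩ := Function.ne_iff.1 hv
  have h2 : expIntegral N t = 0 := by
    ext a b
    have := congrFun (congrFun h1 i) b
    simpa [V, Matrix.mul_apply, show v i ≠ 0 from hi] using this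
  have hz : z = 0 := by
    refine h z hs ?_
    have h3 := expIntegral_mul_self N t
    rw [h2, zero_mul] at h3
    have h4 : exp (t • N) = Matrix.diagonal fun _ => Complex.exp (z * t) := by
      rw [hN, show t • Matrix.diagonal (fun _ : Unit => z) = Matrix.diagonal fun _ => z * t by
        ext a b; simp [Matrix.diagonal, mul_comm], Matrix.exp_diagonal]
      congr 1
      ext a
      rw [Pi.coe_exp, Complex.exp_eq_exp_ℂ]
    have := congrFun (congrFun (h3.trans (congrArg (· - 1) h4)) ()) ()
    simp at this
    linear_combination -this
  rw [show N = 0 by simp [hN, hz], expIntegral_zero] at h2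
  have := congrFun (congrFun h2 ()) ()
  simp at this
  exact ht this

end Complex

end ZOH

namespace ZOH

open NormedSpace Polynomial

/-! ### A complex matrix as a polynomial in its exponential. -/

section ComplexLogarithm

open scoped Matrix.Norms.Operator

variable {ι : Type*} [Fintype ι] [DecidableEq ι]

theorem exp_smul_sub_algebraMap (M : Matrix ι ι ℂ) (t : ℝ) (z : ℂ) :
    exp (t • M) - algebraMap ℂ _ (Complex.exp (z * t)) =
      (M - algebraMap ℂ _ z) *
        (Complex.exp (z * t) • expIntegral (M - algebraMap ℂ _ z) t) := by
  have h1 : exp (t • M) = Complex.exp (z * t) • exp (t • (M - algebraMap ℂ _ z)) := by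
    have hz : t • algebraMap ℂ (Matrix ι ι ℂ) z = algebraMap ℂ _ (z * t) := by
      ext i j
      simp [Matrix.algebraMap_matrix_apply, mul_comm]
    have h2 : t • M = algebraMap ℂ _ (z * t) + t • (M - algebraMap ℂ _ z) := by
      rw [smul_sub, hz]; abel
    conv_lhs => rw [h2]
    have he : algebraMap ℂ (Matrix ι ι ℂ) (Complex.exp (z * t)) =
        exp (algebraMap ℂ (Matrix ι ι ℂ) (z * t)) := by
      rw [Complex.exp_eq_exp_ℂ]
      exact algebraMap_exp_comm _
    rw [Matrix.exp_add_of_commute _ _ (Algebra.commute_algebraMap_left _ _), ← he]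
    exact (Algebra.smul_def _ _).symm
  have h3 := expIntegral_mul_self (M - algebraMap ℂ _ z) t
  have h4 := (commute_expIntegral (Commute.refl (M - algebraMap ℂ _ z)) t).eq
  rw [mul_smul_comm, h4, h3, smul_sub, Algebra.algebraMap_eq_smul_one (Complex.exp _)]
  exact congrArg (· - _) h1

theorem exp_smul_mulVec {M : Matrix ι ι ℂ} {z : ℂ} {v : ι → ℂ} (h : M.mulVec v = z • v) (t : ℝ) :
    (exp (t • M)).mulVec v = Complex.exp (z * t) • v := by
  have h1 := exp_smul_sub_algebraMap M t z
  rw [mul_smul_comm, (commute_expIntegral (Commute.refl (M - algebraMap ℂ _ z)) t).eq,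
    sub_eq_iff_eq_add] at h1
  rw [h1, Matrix.add_mulVec, Matrix.smul_mulVec, ← Matrix.mulVec_mulVec, Matrix.sub_mulVec, h]
  simp [Algebra.algebraMap_eq_smul_one, Matrix.smul_mulVec]

/-- If `c` is no eigenvalue of `e^{tM}`, the difference is itself a unit. Otherwise `c = e^{zt}` for
an eigenvalue `z` of `M`, and `M - z` splits off; non-pathology makes the cofactor invertible. -/
theorem exists_factor_exp_sub {M : Matrix ι ι ℂ} {t : ℝ} (ht : t ≠ 0)
    (h : NonPathologicalOn (spectrum ℂ M) t) (c : ℂ) :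
    ∃ p : ℂ[X], p ≠ 0 ∧ p.natDegree ≤ 1 ∧ ∃ u : Matrix ι ι ℂ, IsUnit u ∧ Commute M u ∧
      exp (t • M) - algebraMap ℂ _ c = aeval M p * u := by
  have hcomm : Commute M (exp (t • M)) :=
    (Subalgebra.mem_centralizer_iff ℝ).1 (exp_mem_of_forall_pow_mem
      (S := (Subalgebra.centralizer ℝ {M}).toSubmodule) (fun i => by
        simpa [Subalgebra.mem_centralizer_iff] using
          (((Commute.refl M).smul_right t).pow_right i).eq)) M rfl
  have hcomm' : Commute M (exp (t • M) - algebraMap ℂ _ c) :=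
    hcomm.sub_right (Algebra.commutes c M).symm
  by_cases hu : IsUnit (exp (t • M) - algebraMap ℂ _ c)
  · exact ⟨1, one_ne_zero, by simp, _, hu, hcomm', by simp⟩
  · obtain ⟨z, v, hv, hM, hE⟩ := exists_eigenvector_of_commute hcomm' hu
    have hz := mem_spectrum_of_mulVec_eq hv hM
    rw [Matrix.sub_mulVec, exp_smul_mulVec hM, Algebra.algebraMap_eq_smul_one,
      Matrix.smul_mulVec, Matrix.one_mulVec, ← sub_smul, smul_eq_zero_iff_left hv,
      sub_eq_zero] at hE
    subst hE
    refine ⟨X - C z, X_sub_C_ne_zero z, by simp, _, ?_, ?_,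
      (exp_smul_sub_algebraMap M t z).trans (by rw [map_sub, aeval_X, aeval_C])⟩
    · refine IsUnit.smul (Units.mk0 _ (Complex.exp_ne_zero (z * t))) (isUnit_expIntegral ht ?_)
      intro w hw hw1
      have hw2 : w + z ∈ spectrum ℂ M := by
        have := spectrum.add_mem_add_iff (a := M - algebraMap ℂ _ z) (r := w) (s := z)
        simpa using this.2 hw
      have := h hw2 hz (by simp [add_mul, Complex.exp_add, hw1])
      simpa using this
    · exact (commute_expIntegral ((Commute.refl M).sub_right (Algebra.commutes z M).symm)
        t).smul_right _

theorem exists_factor_aeval_exp {M : Matrix ι ι ℂ} {t : ℝ} (ht : t ≠ 0)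
    (h : NonPathologicalOn (spectrum ℂ M) t) (s : Multiset ℂ) :
    ∃ p : ℂ[X], p ≠ 0 ∧ p.natDegree ≤ s.card ∧ ∃ u : Matrix ι ι ℂ, IsUnit u ∧ Commute M u ∧
      aeval (exp (t • M)) (s.map fun c => X - C c).prod = aeval M p * u := by
  induction s using Multiset.induction_on with
  | empty => exact ⟨1, one_ne_zero, by simp, 1, isUnit_one, Commute.one_right _, by simp⟩
  | cons c s ih =>
    obtain ⟨p, hp, hd, u, hu, hc, he⟩ := ih
    obtain ⟨p', hp', hd', u', hu', hc', he'⟩ := exists_factor_exp_sub ht h c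
    refine ⟨p' * p, mul_ne_zero hp' hp, ?_, u' * u, hu'.mul hu, hc'.mul_right hc, ?_⟩
    · rw [Multiset.card_cons]
      exact natDegree_mul_le.trans (by omega)
    · have hcp : Commute (aeval M p) u' := by
        rw [aeval_eq_sum_range]
        exact Commute.sum_left _ _ _ fun i _ => (hc'.pow_left i).smul_left _
      rw [Multiset.map_cons, Multiset.prod_cons, map_mul, he, map_sub, aeval_X, aeval_C, he',
        map_mul, mul_assoc, mul_assoc, ← mul_assoc u', ← hcp.eq, mul_assoc]

/-- Splitting `q` into linear factors turns `q(e^{tM}) = 0` into `p(M) = 0` with `p` nonzero of no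
larger degree. -/
theorem natDegree_minpoly_le_of_aeval_exp {M : Matrix ι ι ℂ} {t : ℝ} (ht : t ≠ 0)
    (h : NonPathologicalOn (spectrum ℂ M) t) {q : ℂ[X]} (hq : q ≠ 0)
    (h0 : aeval (exp (t • M)) q = 0) : (minpoly ℂ M).natDegree ≤ q.natDegree := by
  obtain ⟨p, hp, hd, u, hu, -, he⟩ := exists_factor_aeval_exp ht h q.roots
  rw [(IsAlgClosed.splits q).eq_prod_roots, map_mul, he, aeval_C, ← Algebra.smul_def,
    smul_eq_zero_iff_right (leadingCoeff_ne_zero.2 hq), hu.mul_left_eq_zero] at h0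
  exact (natDegree_le_natDegree (minpoly.degree_le_of_ne_zero ℂ M hp h0)).trans (hd.trans (card_roots' q))

/-- If the step is non-pathological on the spectrum of `M`, then `M` is a polynomial in
`e^{t M}`. -/
theorem exists_aeval_exp_eq {M : Matrix ι ι ℂ} {t : ℝ} (ht : t ≠ 0)
    (h : NonPathologicalOn (spectrum ℂ M) t) : ∃ q : ℂ[X], aeval (exp (t • M)) q = M := by
  set d := (minpoly ℂ M).natDegree
  have hint : IsIntegral ℂ M := Algebra.IsIntegral.isIntegral M
  -- Dimension count: `L₁` is injective on a `d`-dimensional space, and its range lies in that of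
  -- `L₂`, which has dimension at most `d` and contains `M`.
  let L₁ := (aeval (exp (t • M)) : ℂ[X] →ₐ[ℂ] _).toLinearMap.domRestrict (degreeLT ℂ d)
  let L₂ := (aeval M : ℂ[X] →ₐ[ℂ] _).toLinearMap.domRestrict (degreeLT ℂ d)
  have hfin : Module.finrank ℂ (degreeLT ℂ d) = d := by
    rw [(degreeLTEquiv ℂ d).finrank_eq]; simp
  have hinj : Function.Injective L₁ := by
    rw [← LinearMap.ker_eq_bot, LinearMap.ker_eq_bot']
    rintro ⟨q, hq⟩ h0
    by_contra hne
    have hq0 : q ≠ 0 := fun h => hne (Subtype.ext h)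
    have := natDegree_minpoly_le_of_aeval_exp ht h hq0 h0
    have h2 := (natDegree_lt_iff_degree_lt hq0).2 (mem_degreeLT.1 hq)
    omega
  have hL₂ : ∀ f : ℂ[X], aeval M f ∈ LinearMap.range L₂ := fun f =>
    ⟨⟨f %ₘ minpoly ℂ M, mem_degreeLT.2 <| by
      rw [← degree_eq_natDegree (minpoly.ne_zero hint)]
      exact degree_modByMonic_lt _ (minpoly.monic hint)⟩, by
      exact aeval_modByMonic_eq_self_of_root (minpoly.aeval ℂ M)⟩
  have hE : exp (t • M) ∈ (aeval M : ℂ[X] →ₐ[ℂ] _).range := by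
    refine exp_mem_of_forall_pow_mem
      (S := (aeval M : ℂ[X] →ₐ[ℂ] _).range.toSubmodule.restrictScalars ℝ) fun i => ?_
    exact ⟨(C (t : ℂ) * X) ^ i, by simp [Algebra.algebraMap_eq_smul_one]⟩
  have hle : LinearMap.range L₁ ≤ LinearMap.range L₂ := by
    rintro _ ⟨q, rfl⟩
    have : aeval (exp (t • M)) (q : ℂ[X]) ∈ (aeval M : ℂ[X] →ₐ[ℂ] _).range :=
      
      Algebra.adjoin_le (Set.singleton_subset_iff.2 hE) (aeval_mem_adjoin_singleton ℂ _)
    obtain ⟨f, hf⟩ := this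
    have := hL₂ f
    rwa [show aeval M f = L₁ q from hf] at this
  have heq := Submodule.eq_of_le_of_finrank_le hle (by
    rw [LinearMap.finrank_range_of_inj hinj, hfin]
    exact (LinearMap.finrank_range_le L₂).trans hfin.le)
  obtain ⟨q, hq⟩ := heq ▸ hL₂ X
  exact ⟨q, hq.trans (aeval_X M)⟩

end ComplexLogarithm

/-! ### Descent from complex to real matrices. -/

section Complexify

open scoped Matrix.Norms.Operator

theorem complexify_mul {ι κ μ : Type*} [Fintype κ] (M : Matrix ι κ ℝ) (N : Matrix κ μ ℝ) :
    complexify (M * N) = complexify M * complexify N :=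
  Matrix.map_mul

theorem complexify_smul {ι κ : Type*} (t : ℝ) (M : Matrix ι κ ℝ) :
    complexify (t • M) = t • complexify M := by
  ext i j; simp [complexify]

theorem continuous_complexify {ι κ : Type*} :
    Continuous (complexify : Matrix ι κ ℝ → Matrix ι κ ℂ) :=
  continuous_id.matrix_map Complex.continuous_ofReal

variable {ι : Type*} [Fintype ι] [DecidableEq ι]

theorem complexify_pow (M : Matrix ι ι ℝ) (i : ℕ) : complexify (M ^ i) = complexify M ^ i :=
  map_pow (algebraMap ℝ ℂ).mapMatrix M i

theorem complexify_exp (M : Matrix ι ι ℝ) : complexify (exp M) = exp (complexify M) :=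
  map_exp (algebraMap ℝ ℂ).mapMatrix continuous_complexify M

theorem complexify_expIntegral (M : Matrix ι ι ℝ) (t : ℝ) :
    complexify (expIntegral M t) = expIntegral (complexify M) t := by
  have := clm_expIntegral ⟨(Algebra.ofId ℝ ℂ).mapMatrix.toLinearMap, continuous_complexify⟩ M t
  refine this.trans (intervalIntegral.integral_congr fun s _ => ?_)
  exact (complexify_exp _).trans (by rw [complexify_smul]; rfl)

theorem exists_real_aeval_eq {M N : Matrix ι ι ℝ} {q : ℂ[X]}
    (h : aeval (complexify M) q = complexify N) : ∃ p : ℝ[X], aeval M p = N := by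
  -- Powers of a real matrix are real, so taking real parts of the coefficients preserves the
  -- identity.
  refine ⟨∑ i ∈ Finset.range (q.natDegree + 1), C (q.coeff i).re * X ^ i, ?_⟩
  rw [aeval_eq_sum_range] at h
  ext a b
  have := congrArg Complex.re (congrFun (congrFun h a) b)
  simp only [← complexify_pow] at this
  simpa [complexify, Matrix.sum_apply, Algebra.algebraMap_eq_smul_one] using this

theorem exists_aeval_exp_smul_eq {A : Matrix ι ι ℝ} {t : ℝ} (ht : t ≠ 0)
    (h : NonPathologicalOn (spectrum ℂ (complexify A)) t) :
    ∃ p : ℝ[X], aeval (exp (t • A)) p = A := by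
  obtain ⟨q, hq⟩ := exists_aeval_exp_eq ht h
  exact exists_real_aeval_eq (q := q) (by rwa [complexify_exp, complexify_smul])

theorem exists_mulVec_eq_of_mem_spectrum {M : Matrix ι ι ℂ} {z : ℂ} (h : z ∈ spectrum ℂ M) :
    ∃ v : ι → ℂ, v ≠ 0 ∧ M.mulVec v = z • v := by
  rw [← Matrix.spectrum_toLin', ← Module.End.hasEigenvalue_iff_mem_spectrum] at h
  obtain ⟨v, hv⟩ := h.exists_hasEigenvector
  exact ⟨v, hv.2, by simpa using hv.apply_eq_smul⟩

theorem conj_mem_spectrum_complexify {A : Matrix ι ι ℝ} {z : ℂ}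
    (h : z ∈ spectrum ℂ (complexify A)) : starRingEnd ℂ z ∈ spectrum ℂ (complexify A) := by
  obtain ⟨v, hv, h⟩ := exists_mulVec_eq_of_mem_spectrum h
  refine mem_spectrum_of_mulVec_eq (v := star v) (by simpa using hv) ?_
  have := congrArg star h
  ext i
  have := congrFun this i
  simpa [Matrix.mulVec, dotProduct, complexify] using this

theorem isUnit_expIntegral_real {A : Matrix ι ι ℝ} {t : ℝ} (ht : t ≠ 0)
    (h : NonPathologicalOn (spectrum ℂ (complexify A)) t) : IsUnit (expIntegral A t) := by
  have hu : IsUnit (complexify (expIntegral A t)) := by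
    rw [complexify_expIntegral]
    refine isUnit_expIntegral ht fun z hz h1 => ?_
    -- If `e^{zt} = 1`, the conjugate eigenvalue has the same exponential. Injectivity makes `z`
    -- real, and then `z = 0`.
    have h2 := h hz (conj_mem_spectrum_complexify hz) (by
      have := congrArg (starRingEnd ℂ) h1
      rw [← Complex.exp_conj] at this
      simpa [h1, eq_comm] using this)
    rw [eq_comm, Complex.conj_eq_iff_re] at h2
    rw [← h2, ← Complex.ofReal_mul, ← Complex.ofReal_exp, Complex.ofReal_eq_one,
      Real.exp_eq_one_iff, mul_eq_zero, or_iff_left ht] at h1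
    rw [← h2, h1, Complex.ofReal_zero]
  rw [Matrix.isUnit_iff_isUnit_det, isUnit_iff_ne_zero] at hu ⊢
  intro h0
  apply hu
  have := RingHom.map_det (algebraMap ℝ ℂ) (expIntegral A t)
  rw [h0, map_zero] at this
  exact this.symm

end Complexify

end ZOH

namespace ZOH

open NormedSpace Polynomial

/-! ### Krylov spaces: invariance and transport. -/

section Krylov

theorem col_mul_eq_mulVec {K ι κ μ : Type*} [Field K] [Fintype μ] (A : Matrix ι μ K) (W : Matrix μ κ K) (c : κ) :
    (A * W).col c = A.mulVec (W.col c) := by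
  ext i; simp [Matrix.mul_apply, Matrix.mulVec, dotProduct]

variable {K ι κ μ : Type*} [Field K] [Fintype ι] [DecidableEq ι] [Fintype μ] [DecidableEq μ]

theorem krylov_le_iff {r : ℕ} {A : Matrix ι ι K} {W : Matrix ι κ K} {S : Submodule K (ι → K)} :
    krylov r A W ≤ S ↔ ∀ i < r, ∀ c, (A ^ i * W).col c ∈ S := by
  rw [krylov, Submodule.span_le]
  constructor
  · exact fun h i hi c => h ⟨i, hi, c, rfl⟩
  · rintro h _ ⟨i, hi, c, rfl⟩
    exact h i hi c

theorem col_pow_mul_mem_krylov {r i : ℕ} (hi : i < r) (A : Matrix ι ι K) (W : Matrix ι κ K)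
    (c : κ) : (A ^ i * W).col c ∈ krylov r A W :=
  krylov_le_iff.1 le_rfl i hi c

theorem col_aeval_mul_mem_krylov {r : ℕ} (hr : Fintype.card ι ≤ r) (A : Matrix ι ι K)
    (W : Matrix ι κ K) (p : K[X]) (c : κ) : (aeval A p * W).col c ∈ krylov r A W := by
  -- For empty `ι` the bound `r` may be `0`, so the degree estimate below would fail.
  rcases isEmpty_or_nonempty ι with h | h
  · rw [Subsingleton.elim ((aeval A p * W).col c) 0]
    exact Submodule.zero_mem _
  · have hd : (p %ₘ A.charpoly).natDegree < r := by
      refine lt_of_lt_of_le ?_ hr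
      rw [← A.charpoly_natDegree_eq_dim]
      refine natDegree_modByMonic_lt _ A.charpoly_monic fun h1 => ?_
      have := A.charpoly_natDegree_eq_dim
      rw [h1, natDegree_one] at this
      exact Fintype.card_ne_zero this.symm
    rw [← aeval_modByMonic_eq_self_of_root A.aeval_self_charpoly, aeval_eq_sum_range' hd,
      Matrix.sum_mul, show Matrix.col (∑ i ∈ Finset.range r, _) c =
        ∑ i ∈ Finset.range r, Matrix.col (((p %ₘ A.charpoly).coeff i • A ^ i) * W) c by
          ext i; simp [Matrix.sum_apply]]
    refine Submodule.sum_mem _ fun i hi => ?_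
    rw [Matrix.smul_mul]
    exact Submodule.smul_mem _ _ (col_pow_mul_mem_krylov (Finset.mem_range.1 hi) A W c)

theorem aeval_mulVec_mem_krylov {r : ℕ} (hr : Fintype.card ι ≤ r) (A : Matrix ι ι K)
    (W : Matrix ι κ K) (p : K[X]) {v : ι → K} (hv : v ∈ krylov r A W) :
    (aeval A p).mulVec v ∈ krylov r A W := by
  suffices krylov r A W ≤ (krylov r A W).comap (aeval A p).mulVecLin from this hv
  rw [krylov_le_iff]
  intro i _ c
  have := col_aeval_mul_mem_krylov hr A W (p * X ^ i) c
  simpa [Matrix.mul_assoc, col_mul_eq_mulVec] using this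

theorem krylov_le_krylov {r s : ℕ} (hr : Fintype.card ι ≤ r) (A : Matrix ι ι K)
    (W : Matrix ι κ K) : krylov s A W ≤ krylov r A W :=
  krylov_le_iff.2 fun i _ c => by simpa using col_aeval_mul_mem_krylov hr A W (X ^ i) c

theorem map_krylov {r : ℕ} {A : Matrix ι ι K} {A' : Matrix μ μ K} {P : Matrix ι μ K}
    {W : Matrix ι κ K} {W' : Matrix μ κ K} (hA : A * P = P * A') (hW : W = P * W') :
    (krylov r A' W').map P.mulVecLin = krylov r A W := by
  apply le_antisymm
  · rw [Submodule.map_le_iff_le_comap, krylov_le_iff]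
    intro i hi c
    have := col_pow_mul_mem_krylov hi A W c
    rw [hW, ← Matrix.mul_assoc, pow_intertwine hA, Matrix.mul_assoc, col_mul_eq_mulVec] at this
    rwa [hW]
  · rw [krylov_le_iff]
    intro i hi c
    rw [hW, ← Matrix.mul_assoc, pow_intertwine hA, Matrix.mul_assoc, col_mul_eq_mulVec]
    exact Submodule.mem_map_of_mem (col_pow_mul_mem_krylov hi A' W' c)

end Krylov

/-! ### Compression to an invariant Krylov space. -/

section Reduction

theorem mulVecLin_injective_of_mul_eq_one {K ι μ : Type*} [Field K] [Fintype ι] [Fintype μ]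
    [DecidableEq μ] {P : Matrix ι μ K} {Q : Matrix μ ι K} (hQ : Q * P = 1) :
    Function.Injective P.mulVecLin := fun x y h => by
  simpa [hQ] using congrArg Q.mulVec h

variable {K ι κ μ : Type*} [Field K] [Fintype ι] [Fintype μ] [DecidableEq μ]
  {P : Matrix ι μ K} {Q : Matrix μ ι K}

theorem mul_mul_eq_of_col_mem_range (hQ : Q * P = 1) {W : Matrix ι κ K}
    (hW : ∀ c, W.col c ∈ LinearMap.range P.mulVecLin) : P * (Q * W) = W := by
  refine Matrix.ext_col fun c => ?_
  obtain ⟨y, hy⟩ := hW c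
  rw [col_mul_eq_mulVec, col_mul_eq_mulVec, ← hy, Matrix.mulVecLin_apply,
    Matrix.mulVec_mulVec _ Q P, hQ, Matrix.one_mulVec]

theorem card_le_of_mul_eq_one (hQ : Q * P = 1) : Fintype.card μ ≤ Fintype.card ι := by
  simpa using LinearMap.finrank_le_finrank_of_injective (mulVecLin_injective_of_mul_eq_one hQ)

variable [DecidableEq ι] {r : ℕ} {A : Matrix ι ι K} {W : Matrix ι κ K}

theorem mul_eq_mul_compression (hr : Fintype.card ι ≤ r) (hQ : Q * P = 1)
    (hV : LinearMap.range P.mulVecLin = krylov r A W) : A * P = P * (Q * A * P) := by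
  rw [Matrix.mul_assoc Q, mul_mul_eq_of_col_mem_range hQ]
  intro c
  have h : P.col c ∈ krylov r A W := hV ▸ ⟨Pi.single c 1, by simp⟩
  rw [hV, col_mul_eq_mulVec]
  simpa using aeval_mulVec_mem_krylov hr A W X h

theorem mul_compression_eq (hr : Fintype.card ι ≤ r) (hQ : Q * P = 1)
    (hV : LinearMap.range P.mulVecLin = krylov r A W) : P * (Q * W) = W :=
  mul_mul_eq_of_col_mem_range hQ fun c => by
    rw [hV]; simpa using col_aeval_mul_mem_krylov hr A W 1 c

theorem krylov_compression_eq_top {s : ℕ} (hr : Fintype.card ι ≤ r) (hs : Fintype.card μ ≤ s)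
    (hQ : Q * P = 1) (hV : LinearMap.range P.mulVecLin = krylov r A W) :
    krylov s (Q * A * P) (Q * W) = ⊤ := by
  refine top_le_iff.1 (le_trans (top_le_iff.2 ?_) (krylov_le_krylov (s := r) hs _ _))
  apply Submodule.map_injective_of_injective (mulVecLin_injective_of_mul_eq_one hQ)
  rw [map_krylov (mul_eq_mul_compression hr hQ hV) (mul_compression_eq hr hQ hV).symm,
    Submodule.map_top, hV]

end Reduction

theorem exists_coordinates {K ι : Type*} [Field K] [Fintype ι] [DecidableEq ι]
    (V : Submodule K (ι → K)) : ∃ (k : ℕ) (P : Matrix ι (Fin k) K) (Q : Matrix (Fin k) ι K),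
      Q * P = 1 ∧ LinearMap.range P.mulVecLin = V := by
  let e := (Module.finBasis K V).equivFun.symm
  let f : (Fin (Module.finrank K V) → K) →ₗ[K] (ι → K) := V.subtype ∘ₗ e.toLinearMap
  obtain ⟨g, hg⟩ := f.exists_leftInverse_of_injective
    (LinearMap.ker_eq_bot.2 (V.subtype_injective.comp e.injective))
  refine ⟨_, f.toMatrix', g.toMatrix', ?_, ?_⟩
  · rw [← LinearMap.toMatrix'_comp, hg, LinearMap.toMatrix'_id]
  · rw [← Matrix.toLin'_apply', Matrix.toLin'_toMatrix', LinearMap.range_comp]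
    simp

/-! ### Sampling a generating pair, and the spectrum of the compression. -/

section Discretization

open scoped Matrix.Norms.Operator

variable {ι κ : Type*} [Fintype ι] [DecidableEq ι]

theorem zohB_eq {n m : ℕ} (A : Matrix (Fin n) (Fin n) ℝ) (B : Matrix (Fin n) (Fin m) ℝ) (t : ℝ) :
    zohB A B t = expIntegral A t * B := by
  ext i j
  have := clm_expIntegral (LinearMap.toContinuousLinearMap
    (Matrix.entryLinearMap ℝ ℝ i j ∘ₗ mulRightLinearMap (Fin n) ℝ B)) A t
  simp only [LinearMap.coe_toContinuousLinearMap', LinearMap.comp_apply,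
    mulRightLinearMap_apply, Matrix.entryLinearMap_apply] at this
  exact this.symm

/-- The columnwise alternative for `W'` covers both `B_d` and `[x₀ B_d]`, where `x₀` is not
multiplied by the integral. -/
theorem krylov_exp_eq_top {r : ℕ} (hr : Fintype.card ι ≤ r) {A : Matrix ι ι ℝ} {t : ℝ}
    (ht : t ≠ 0) (h : NonPathologicalOn (spectrum ℂ (complexify A)) t) {W W' : Matrix ι κ ℝ}
    (hW : krylov r A W = ⊤)
    (hW' : ∀ c, W'.col c = W.col c ∨ W'.col c = (expIntegral A t).mulVec (W.col c)) :
    krylov r (exp (t • A)) W' = ⊤ := by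
  obtain ⟨p, hp⟩ := exists_aeval_exp_smul_eq ht h
  set S := krylov r (exp (t • A)) W' with hS
  have hA : ∀ v ∈ S, A.mulVec v ∈ S := fun v hv => by
    have := aeval_mulVec_mem_krylov hr (exp (t • A)) W' p hv
    rwa [hp] at this
  have hApow : ∀ i : ℕ, ∀ v ∈ S, (A ^ i).mulVec v ∈ S := fun i => by
    induction i with
    | zero => simp
    | succ i ih =>
      intro v hv
      rw [pow_succ, ← Matrix.mulVec_mulVec]
      exact ih _ (hA v hv)
  have hΨ : ∀ v ∈ S, (expIntegral A t).mulVec v ∈ S := fun v hv => by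
    let f : Matrix ι ι ℝ →ₗ[ℝ] ι → ℝ := LinearMap.applyₗ v ∘ₗ Matrix.toLin'.toLinearMap
    exact expIntegral_mem_of_forall_pow_mem (S := S.comap f) (fun i => hApow i v hv) t
  have hcol : ∀ c, W'.col c ∈ S := fun c => by
    simpa using col_aeval_mul_mem_krylov hr (exp (t • A)) W' 1 c
  -- The left side is the image of `krylov r A W = ⊤` under the invertible `expIntegral A t`, hence
  -- everything.
  have hle : krylov r A (expIntegral A t * W) ≤ S := by
    rw [krylov_le_iff]
    intro i _ c
    rw [col_mul_eq_mulVec, col_mul_eq_mulVec]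
    refine hApow i _ ?_
    rcases hW' c with h1 | h1
    · rw [← h1]; exact hΨ _ (hcol c)
    · rw [← h1]; exact hcol c
  rw [← map_krylov (commute_expIntegral (Commute.refl A) t).eq rfl, hW, Submodule.map_top,
    LinearMap.range_eq_top.2 ?_] at hle
  · exact top_le_iff.1 hle
  · exact (Matrix.mulVec_surjective_iff_isUnit.2 (isUnit_expIntegral_real ht h))

theorem complexify_mulVec_mem_krylov {r : ℕ} {A : Matrix ι ι ℝ} {W : Matrix ι κ ℝ}
    {v : ι → ℝ} (hv : v ∈ krylov r A W) :
    (fun i => (v i : ℂ)) ∈ krylov r (complexify A) (complexify W) := by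
  suffices krylov r A W ≤ ((krylov r (complexify A) (complexify W)).restrictScalars ℝ).comap
      (LinearMap.pi fun i => Complex.ofRealCLM.toLinearMap ∘ₗ LinearMap.proj i) from this hv
  rw [krylov_le_iff]
  intro i hi c
  have := col_pow_mul_mem_krylov hi (complexify A) (complexify W) c
  rwa [← complexify_pow, ← complexify_mul] at this

/-- Eigenvalues of the compression of `A` to a Krylov space have an eigenvector of `A` in the
complexified Krylov space. -/
theorem exists_eigenvector_mem_krylov {μ : Type*} [Fintype μ] [DecidableEq μ] {r : ℕ}
    {A : Matrix ι ι ℝ} {W : Matrix ι κ ℝ} {P : Matrix ι μ ℝ} {Q : Matrix μ ι ℝ}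
    (hr : Fintype.card ι ≤ r) (hQ : Q * P = 1)
    (hV : LinearMap.range P.mulVecLin = krylov r A W) {z : ℂ}
    (hz : z ∈ spectrum ℂ (complexify (Q * A * P))) :
    ∃ v ∈ krylov r (complexify A) (complexify W), v ≠ 0 ∧
      (complexify A).mulVec v = z • v := by
  obtain ⟨v, hv, h⟩ := exists_mulVec_eq_of_mem_spectrum hz
  refine ⟨(complexify P).mulVec v, ?_, ?_, ?_⟩
  · rw [Matrix.mulVec_eq_sum]
    refine Submodule.sum_mem _ fun j _ => ?_
    rw [op_smul_eq_smul]
    refine Submodule.smul_mem _ _ ?_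
    exact complexify_mulVec_mem_krylov (v := P.col j) (hV ▸ ⟨Pi.single j 1, by simp⟩)
  · intro h0
    apply hv
    have := congrArg (complexify Q).mulVec h0
    rwa [Matrix.mulVec_mulVec, ← complexify_mul, hQ, Matrix.mulVec_zero,
      show complexify (1 : Matrix μ μ ℝ) = 1 from map_one (algebraMap ℝ ℂ).mapMatrix,
      Matrix.one_mulVec] at this
  · rw [Matrix.mulVec_mulVec, ← complexify_mul, mul_eq_mul_compression hr hQ hV, complexify_mul,
      ← Matrix.mulVec_mulVec, h, Matrix.mulVec_smul]

end Discretization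

end ZOH

namespace ZOH

open NormedSpace

/-! ### Exactness of zero-order-hold sampling. -/

section ExactDiscretization

open scoped Matrix.Norms.Operator

variable {n m : ℕ}

theorem dtState_add (F : Matrix (Fin n) (Fin n) ℝ) (G : Matrix (Fin n) (Fin m) ℝ)
    (x₀ : Fin n → ℝ) (u : ℕ → Fin m → ℝ) (j i : ℕ) :
    dtState F G x₀ u (j + i) = (F ^ i).mulVec (dtState F G x₀ u j) +
      ∑ l ∈ Finset.range i, (F ^ (i - 1 - l) * G).mulVec (u (j + l)) := by
  induction i with
  | zero => simp
  | succ i ih =>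
    rw [← add_assoc, dtState, ih, Matrix.mulVec_add, Matrix.mulVec_mulVec, ← pow_succ',
      Finset.sum_range_succ, Matrix.mulVec_sum, add_assoc]
    congr 2
    · refine Finset.sum_congr rfl fun l hl => ?_
      have := Finset.mem_range.1 hl
      rw [Matrix.mulVec_mulVec, ← Matrix.mul_assoc, ← pow_succ']
      congr 3
      omega
    · simp

/-- The open interval suffices, as the integrals do not see endpoints. -/
theorem hold_eq {Δ s : ℝ} (hΔ : 0 < Δ) (u : ℕ → Fin m → ℝ) {i : ℕ}
    (hs : s ∈ Set.Ioo (i * Δ) ((i + 1 : ℕ) * Δ)) : hold Δ u s = u i := by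
  rw [hold]
  congr 1
  have h0 : (i : ℝ) ≤ s / Δ := (le_div_iff₀ hΔ).2 hs.1.le
  rw [Nat.floor_eq_iff (i.cast_nonneg.trans h0)]
  exact ⟨h0, (div_lt_iff₀ hΔ).2 (by simpa using hs.2)⟩

theorem continuous_exp_sub_mulVec (A : Matrix (Fin n) (Fin n) ℝ) (B : Matrix (Fin n) (Fin m) ℝ)
    (t : ℝ) (w : Fin m → ℝ) (c : Fin n) :
    Continuous fun s : ℝ => (exp ((t - s) • A) * B).mulVec w c := by
  have h : Continuous fun s : ℝ => exp ((t - s) • A) :=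
    (continuous_exp_smul A).comp (continuous_const.sub continuous_id)
  exact (continuous_apply c).comp ((h.matrix_mul continuous_const).matrix_mulVec continuous_const)

theorem intervalIntegrable_hold {Δ : ℝ} (hΔ : 0 < Δ) (A : Matrix (Fin n) (Fin n) ℝ)
    (B : Matrix (Fin n) (Fin m) ℝ) (u : ℕ → Fin m → ℝ) (t : ℝ) (c : Fin n) (i : ℕ) :
    IntervalIntegrable (fun s : ℝ => (exp ((t - s) • A) * B).mulVec (hold Δ u s) c)
      MeasureTheory.volume (i * Δ) ((i + 1 : ℕ) * Δ) := by
  refine IntervalIntegrable.congr_uIoo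
    (f := fun s : ℝ => (exp ((t - s) • A) * B).mulVec (u i) c) ?_ ?_
  · exact (continuous_exp_sub_mulVec A B t (u i) c).intervalIntegrable _ _
  · intro s hs
    rw [Set.uIoo_of_le (by gcongr; simp)] at hs
    simp only [hold_eq hΔ u hs]

theorem integral_hold {Δ : ℝ} (hΔ : 0 < Δ) (A : Matrix (Fin n) (Fin n) ℝ)
    (B : Matrix (Fin n) (Fin m) ℝ) (u : ℕ → Fin m → ℝ) (t : ℝ) (c : Fin n) (i : ℕ) :
    ∫ s in (i * Δ)..((i + 1 : ℕ) * Δ), (exp ((t - s) • A) * B).mulVec (hold Δ u s) c =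
      (exp ((t - (i + 1 : ℕ) * Δ) • A) * zohB A B Δ).mulVec (u i) c := by
  rw [intervalIntegral.integral_congr_Ioo_of_le (by gcongr; simp)
    (g := fun s : ℝ => (exp ((t - s) • A) * B).mulVec (u i) c)
    (fun s hs => by simp only [hold_eq hΔ u hs])]
  set b : ℝ := (i + 1 : ℕ) * Δ with hb
  -- With `b` the right end of the holding interval, `e^{(t-s)A} = e^{(t-b)A} e^{(b-s)A}`; the first
  -- factor is constant and the substitution `s ↦ b - s` produces `B_d`.
  let f : Matrix (Fin n) (Fin n) ℝ →ₗ[ℝ] ℝ :=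
    { toFun := fun X => (exp ((t - b) • A) * (X * B)).mulVec (u i) c
      map_add' := fun X Y => by simp [Matrix.add_mul, Matrix.mul_add, Matrix.add_mulVec]
      map_smul' := fun r X => by simp [Matrix.smul_mulVec] }
  have h1 := clm_expIntegral f.toContinuousLinearMap A Δ
  rw [zohB_eq]
  refine Eq.trans ?_ h1.symm
  have h2 := intervalIntegral.integral_comp_sub_left (a := i * Δ) (b := b)
    (fun s => f (exp (s • A))) b
  rw [sub_self, show b - i * Δ = Δ by rw [hb]; push_cast; ring] at h2
  refine Eq.trans (intervalIntegral.integral_congr fun s _ => ?_) h2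
  change _ = (exp ((t - b) • A) * (exp ((b - s) • A) * B)).mulVec (u i) c
  rw [← Matrix.mul_assoc, ← Matrix.exp_add_of_commute _ _
    (((Commute.refl A).smul_left _).smul_right _), ← add_smul, sub_add_sub_cancel]

/-- Zero-order-hold discretization is exact at the sampling instants. -/
theorem response_hold {Δ : ℝ} (hΔ : 0 < Δ) (A : Matrix (Fin n) (Fin n) ℝ)
    (B : Matrix (Fin n) (Fin m) ℝ) (x₀ : Fin n → ℝ) (u : ℕ → Fin m → ℝ) (j : ℕ) :
    response A B x₀ (hold Δ u) (j * Δ) = dtState (zohA A Δ) (zohB A B Δ) x₀ u j := by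
  have hpow : ∀ i : ℕ, exp ((i * Δ) • A) = zohA A Δ ^ i := fun i => by
    rw [zohA, ← Matrix.exp_nsmul, mul_smul, Nat.cast_smul_eq_nsmul]
  have h := dtState_add (zohA A Δ) (zohB A B Δ) x₀ u 0 j
  rw [zero_add] at h
  rw [h, response, hpow]
  congr 1
  ext c
  have hs := intervalIntegral.sum_integral_adjacent_intervals
    (a := fun i : ℕ => (i : ℝ) * Δ) (n := j)
    (fun i _ => intervalIntegrable_hold hΔ A B u (j * Δ) c i)
  simp only [Nat.cast_zero, zero_mul] at hs
  rw [← hs, Finset.sum_apply]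
  refine Finset.sum_congr rfl fun i hi => ?_
  have hi := Finset.mem_range.1 hi
  rw [integral_hold hΔ, zero_add, ← hpow]
  congr 6
  rw [Nat.sub_sub, Nat.cast_sub (by omega)]
  push_cast
  ring

end ExactDiscretization

/-! ### Persistent excitation and the Gramian. -/

section Informativeness

open Matrix

variable {k m : ℕ}

/-- The weights form a vector in the left kernel of the Hankel matrix, whose rows are independent.
-/
theorem PersistentlyExciting.eq_zero {r N : ℕ} {u : ℕ → Fin m → ℝ}
    (h : PersistentlyExciting r N u) {w : ℕ → Fin m → ℝ}
    (hw : ∀ j, j + r ≤ N → ∑ l ∈ Finset.range r, w l ⬝ᵥ u (j + l) = 0) {l : ℕ} (hl : l < r) :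
    w l = 0 := by
  have hli : LinearIndependent ℝ (hankel r N u).row := by
    rw [linearIndependent_iff_card_eq_finrank_span, Set.finrank, ← rank_eq_finrank_span_row, h.2]
    simp
  have hinj := vecMul_injective_iff.2 hli
  have h0 : (fun p : Fin r × Fin m => w p.1 p.2) ᵥ* hankel r N u = 0 := by
    ext j
    rw [vecMul, dotProduct, Fintype.sum_prod_type, Pi.zero_apply, ← hw j (by omega),
      ← Fin.sum_univ_eq_sum_range (fun l => w l ⬝ᵥ u (j + l))]
    refine Finset.sum_congr rfl fun i _ => ?_
    simp [dotProduct, hankel, add_comm]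
  have := hinj (h0.trans (zero_vecMul _).symm)
  ext c
  exact congrFun this (⟨l, hl⟩, c)

/-- The weight of `u[j + l]` in `η ⬝ ξ[j + i] + v ⬝ u[j + i]`. -/
def inputWeight (F : Matrix (Fin k) (Fin k) ℝ) (G : Matrix (Fin k) (Fin m) ℝ) (η : Fin k → ℝ)
    (v : Fin m → ℝ) (i l : ℕ) : Fin m → ℝ :=
  if l < i then η ᵥ* (F ^ (i - 1 - l) * G) else if l = i then v else 0

theorem dotProduct_dtState_add (F : Matrix (Fin k) (Fin k) ℝ) (G : Matrix (Fin k) (Fin m) ℝ)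
    (x₀ : Fin k → ℝ) (u : ℕ → Fin m → ℝ) (η : Fin k → ℝ) (v : Fin m → ℝ) (j : ℕ) {i r : ℕ}
    (hi : i < r) :
    η ⬝ᵥ dtState F G x₀ u (j + i) + v ⬝ᵥ u (j + i) =
      η ⬝ᵥ (F ^ i *ᵥ dtState F G x₀ u j) +
        ∑ l ∈ Finset.range r, inputWeight F G η v i l ⬝ᵥ u (j + l) := by
  have h : ∑ l ∈ Finset.range r, inputWeight F G η v i l ⬝ᵥ u (j + l) =
      ∑ l ∈ Finset.range (i + 1), inputWeight F G η v i l ⬝ᵥ u (j + l) := by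
    refine (Finset.sum_subset (Finset.range_mono hi) fun l _ hl => ?_).symm
    rw [Finset.mem_range] at hl
    rw [inputWeight, if_neg (by omega), if_neg (by omega), zero_dotProduct]
  rw [h, Finset.sum_range_succ, dtState_add, dotProduct_add, dotProduct_sum, add_assoc]
  congr 2
  · refine Finset.sum_congr rfl fun l hl => ?_
    rw [inputWeight, if_pos (Finset.mem_range.1 hl), dotProduct_mulVec]
  · simp [inputWeight]

theorem eq_zero_of_dotProduct_eq_zero {F : Matrix (Fin k) (Fin k) ℝ}
    {G : Matrix (Fin k) (Fin m) ℝ} {x₀ : Fin k → ℝ} (hc : krylov k F (augment x₀ G) = ⊤)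
    {u : ℕ → Fin m → ℝ} {N : ℕ} (hu : PersistentlyExciting (k + 1) N u) {η : Fin k → ℝ}
    {v : Fin m → ℝ} (h : ∀ j < N, η ⬝ᵥ dtState F G x₀ u j + v ⬝ᵥ u j = 0) : η = 0 ∧ v = 0 := by
  have hN := hu.1
  set a := F.charpoly.coeff
  have hdeg : F.charpoly.natDegree = k := by simp [F.charpoly_natDegree_eq_dim]
  have hak : a k = 1 := by
    have := F.charpoly_monic.coeff_natDegree
    rwa [hdeg] at this
  have hCH : ∑ i ∈ Finset.range (k + 1), a i • F ^ i = 0 := by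
    have := F.aeval_self_charpoly
    rwa [Polynomial.aeval_eq_sum_range, hdeg] at this
  have hw : ∀ l < k + 1, ∑ i ∈ Finset.range (k + 1), a i • inputWeight F G η v i l = 0 := by
    refine fun l hl => hu.eq_zero
      (w := fun l => ∑ i ∈ Finset.range (k + 1), a i • inputWeight F G η v i l) (fun j hj => ?_) hl
    have h1 : ∑ i ∈ Finset.range (k + 1),
        a i * (η ⬝ᵥ dtState F G x₀ u (j + i) + v ⬝ᵥ u (j + i)) = 0 :=
      Finset.sum_eq_zero fun i hi => by
        rw [h _ (by have := Finset.mem_range.1 hi; omega), mul_zero]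
    have h2 : ∑ i ∈ Finset.range (k + 1), a i * (η ⬝ᵥ (F ^ i *ᵥ dtState F G x₀ u j)) = 0 := by
      have := congrArg (fun X => η ⬝ᵥ (X *ᵥ dtState F G x₀ u j)) hCH
      simpa [sum_mulVec, dotProduct_sum, smul_mulVec] using this
    rw [Finset.sum_congr rfl fun i hi => by
      rw [dotProduct_dtState_add F G x₀ u η v j (Finset.mem_range.1 hi), mul_add],
      Finset.sum_add_distrib, h2, zero_add] at h1
    rw [← h1]
    simp only [sum_dotProduct, smul_dotProduct, smul_eq_mul, Finset.mul_sum]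
    exact Finset.sum_comm
  have hv : v = 0 := by
    -- Only `i = k` contributes to the weight of `u[j + k]`, giving `a k • v = v`.
    have := hw k (by omega)
    rw [Finset.sum_range_succ, Finset.sum_eq_zero fun i hi => by
      have := Finset.mem_range.1 hi
      rw [inputWeight, if_neg (by omega), if_neg (by omega), smul_zero]] at this
    simpa [inputWeight, hak] using this
  have hG : ∀ s < k, η ᵥ* (F ^ s * G) = 0 := by
    intro s
    induction s using Nat.strong_induction_on with
    | _ s ih =>
      intro hs
      -- In this weight the monic term `i = k` gives `η ᵥ* (F ^ s * G)`; the others vanish, involve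
      -- `v = 0`, or carry powers of `F` below `s`.
      have := hw (k - 1 - s) (by omega)
      rw [Finset.sum_range_succ, Finset.sum_eq_zero fun i hi => by
        have hi := Finset.mem_range.1 hi
        rw [inputWeight]
        split_ifs with h1 h2
        · rw [ih _ (by omega) (by omega), smul_zero]
        · rw [hv, smul_zero]
        · rw [smul_zero]] at this
      rwa [inputWeight, if_pos (by omega), hak, one_smul, zero_add,
        show k - 1 - (k - 1 - s) = s by omega] at this
  refine ⟨?_, hv⟩
  have hx : ∀ i < k, η ⬝ᵥ (F ^ i *ᵥ x₀) = 0 := fun i hi => by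
    have h1 := h i (by omega)
    have h2 := dtState_add F G x₀ u 0 i
    rw [zero_add] at h2
    rw [hv, zero_dotProduct, add_zero, h2, dotProduct_add, dotProduct_sum,
      Finset.sum_eq_zero (fun l _ => by
        rw [dotProduct_mulVec, hG _ (by omega), zero_dotProduct]), add_zero] at h1
    exact h1
  have hle : krylov k F (augment x₀ G) ≤ LinearMap.ker (dotProductBilin ℝ ℝ η) := by
    rw [krylov_le_iff]
    rintro i hi (_ | c)
    · rw [col_mul_eq_mulVec]
      exact hx i hi
    · exact congrFun (hG i hi) c
  rw [hc, top_le_iff, LinearMap.ker_eq_top] at hle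
  exact dotProduct_self_eq_zero.1 (LinearMap.congr_fun hle η)

theorem posDef_gramian {ξ : ℕ → Fin k → ℝ} {u : ℕ → Fin m → ℝ} {N : ℕ}
    (h : ∀ (η : Fin k → ℝ) (v : Fin m → ℝ), (∀ j < N, η ⬝ᵥ ξ j + v ⬝ᵥ u j = 0) →
      η = 0 ∧ v = 0) : (gramian ξ u N).PosDef := by
  have hq : ∀ w, w ⬝ᵥ (gramian ξ u N *ᵥ w) =
      ∑ j ∈ Finset.range N, (w ⬝ᵥ Sum.elim (ξ j) (u j)) ^ 2 := fun w => by
    rw [gramian, sum_mulVec, dotProduct_sum]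
    refine Finset.sum_congr rfl fun j _ => ?_
    rw [vecMulVec_mulVec, op_smul_eq_smul, dotProduct_smul, smul_eq_mul, sq,
      dotProduct_comm w]
  refine PosDef.of_dotProduct_mulVec_pos ?_ fun w hw => ?_
  · ext a b
    simp [gramian, Matrix.sum_apply, vecMulVec_apply, mul_comm]
  · rw [star_trivial, hq]
    refine (Finset.sum_nonneg fun _ _ => sq_nonneg _).lt_of_ne' fun h0 => hw ?_
    rw [Finset.sum_eq_zero_iff_of_nonneg fun _ _ => sq_nonneg _] at h0
    obtain ⟨h1, h2⟩ := h (w ∘ Sum.inl) (w ∘ Sum.inr) fun j hj => by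
      have := pow_eq_zero_iff two_ne_zero |>.1 (h0 j (Finset.mem_range.2 hj))
      simpa [dotProduct] using this
    ext (a | a)
    · exact congrFun h1 a
    · exact congrFun h2 a

end Informativeness

end ZOH

/-! ### Assembly: transfer of sampling through the compression. -/

namespace ZOH

open NormedSpace

variable {n m k : ℕ}

theorem mul_augment (P : Matrix (Fin k) (Fin n) ℝ) (x : Fin n → ℝ)
    (B : Matrix (Fin n) (Fin m) ℝ) : P * augment x B = augment (P.mulVec x) (P * B) := by
  rw [augment, Matrix.mul_fromCols, ← Matrix.replicateCol_mulVec]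
  rfl

theorem mul_zohB {A : Matrix (Fin n) (Fin n) ℝ} {A' : Matrix (Fin k) (Fin k) ℝ}
    {P : Matrix (Fin n) (Fin k) ℝ} (h : A * P = P * A') (B : Matrix (Fin k) (Fin m) ℝ) (t : ℝ) :
    P * zohB A' B t = zohB A (P * B) t := by
  rw [zohB_eq, zohB_eq, ← Matrix.mul_assoc, ← Matrix.mul_assoc, expIntegral_intertwine h]

theorem zohA_mul {A : Matrix (Fin n) (Fin n) ℝ} {A' : Matrix (Fin k) (Fin k) ℝ}
    {P : Matrix (Fin n) (Fin k) ℝ} (h : A * P = P * A') (t : ℝ) :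
    zohA A t * P = P * zohA A' t :=
  exp_intertwine (by rw [Matrix.smul_mul, Matrix.mul_smul, h])

theorem mulVec_dtState {F : Matrix (Fin n) (Fin n) ℝ} {F' : Matrix (Fin k) (Fin k) ℝ}
    {P : Matrix (Fin n) (Fin k) ℝ} (h : F * P = P * F') (G : Matrix (Fin k) (Fin m) ℝ)
    (x : Fin k → ℝ) (u : ℕ → Fin m → ℝ) (j : ℕ) :
    P.mulVec (dtState F' G x u j) = dtState F (P * G) (P.mulVec x) u j := by
  induction j with
  | zero => rfl
  | succ j ih =>
    rw [dtState, dtState, ← ih, Matrix.mulVec_add, Matrix.mulVec_mulVec, Matrix.mulVec_mulVec,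
      Matrix.mulVec_mulVec, h]

theorem col_zohB (A : Matrix (Fin n) (Fin n) ℝ) (B : Matrix (Fin n) (Fin m) ℝ) (t : ℝ)
    (c : Fin m) : (zohB A B t).col c = (zohB A 1 t).mulVec (B.col c) := by
  rw [zohB_eq, zohB_eq, Matrix.mul_one, col_mul_eq_mulVec]

theorem compression_spectrum_subset {κ : Type*} {A : Matrix (Fin n) (Fin n) ℝ}
    {W : Matrix (Fin n) κ ℝ} {P : Matrix (Fin n) (Fin k) ℝ} {Q : Matrix (Fin k) (Fin n) ℝ}
    (hQ : Q * P = 1) (hV : LinearMap.range P.mulVecLin = krylov n A W) :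
    spectrum ℂ (complexify (Q * A * P)) ⊆ fullSpectrum A := fun z hz => by
  obtain ⟨v, -, hv, h⟩ := exists_eigenvector_mem_krylov (Fintype.card_fin n).le hQ hV hz
  exact mem_spectrum_of_mulVec_eq hv h

theorem krylov_zoh_compression_eq_top {κ : Type*} {A : Matrix (Fin n) (Fin n) ℝ} {t : ℝ}
    {W : Matrix (Fin n) κ ℝ} {P : Matrix (Fin n) (Fin k) ℝ} {Q : Matrix (Fin k) (Fin n) ℝ}
    {W' : Matrix (Fin k) κ ℝ} {s : ℕ} (ht : t ≠ 0) (hQ : Q * P = 1)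
    (hV : LinearMap.range P.mulVecLin = krylov n A W) (hs : k ≤ s)
    (h : NonPathologicalOn (spectrum ℂ (complexify (Q * A * P))) t)
    (hW' : ∀ c, W'.col c = (Q * W).col c ∨
      W'.col c = (zohB (Q * A * P) 1 t).mulVec ((Q * W).col c)) :
    krylov s (zohA (Q * A * P) t) W' = ⊤ := by
  have hs' : Fintype.card (Fin k) ≤ s := (Fintype.card_fin k).le.trans hs
  refine krylov_exp_eq_top hs' ht h
    (krylov_compression_eq_top (Fintype.card_fin n).le hs' hQ hV) fun c => ?_
  simpa only [zohB_eq, Matrix.mul_one] using hW' c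

theorem krylov_zoh_eq {κ : Type*} {A : Matrix (Fin n) (Fin n) ℝ} {t : ℝ}
    {W Wd : Matrix (Fin n) κ ℝ} {P : Matrix (Fin n) (Fin k) ℝ} {Q : Matrix (Fin k) (Fin n) ℝ}
    {W' : Matrix (Fin k) κ ℝ} (ht : t ≠ 0) (hQ : Q * P = 1)
    (hV : LinearMap.range P.mulVecLin = krylov n A W)
    (h : NonPathologicalOn (spectrum ℂ (complexify (Q * A * P))) t) (hWd : Wd = P * W')
    (hW' : ∀ c, W'.col c = (Q * W).col c ∨
      W'.col c = (zohB (Q * A * P) 1 t).mulVec ((Q * W).col c)) :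
    krylov n (zohA A t) Wd = krylov n A W := by
  have hk : k ≤ n := by simpa using card_le_of_mul_eq_one hQ
  rw [← map_krylov (zohA_mul (mul_eq_mul_compression (Fintype.card_fin n).le hQ hV) t) hWd,
    krylov_zoh_compression_eq_top ht hQ hV hk h hW', Submodule.map_top, hV]

/-- The reachable subspace is preserved by sampling at a non-pathological step. -/
theorem reachable_zoh {A : Matrix (Fin n) (Fin n) ℝ} {B : Matrix (Fin n) (Fin m) ℝ} {t : ℝ}
    (ht : t ≠ 0) (h : NonPathologicalOn (reachableSpectrum A B) t) :
    reachable (zohA A t) (zohB A B t) = reachable A B := by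
  obtain ⟨k, P, Q, hQ, hV⟩ := exists_coordinates (reachable A B)
  have hn := (Fintype.card_fin n).le
  have hAP := mul_eq_mul_compression hn hQ hV
  refine krylov_zoh_eq (W' := zohB (Q * A * P) (Q * B) t) ht hQ hV
    (h.mono fun z hz => exists_eigenvector_mem_krylov hn hQ hV hz) ?_
    fun c => .inr (col_zohB _ _ _ _)
  rw [mul_zohB hAP, mul_compression_eq hn hQ hV]

theorem reachableSpectrum_subset (A : Matrix (Fin n) (Fin n) ℝ) (B : Matrix (Fin n) (Fin m) ℝ) :
    reachableSpectrum A B ⊆ fullSpectrum A := fun _ ⟨_, _, hv, h⟩ => mem_spectrum_of_mulVec_eq hv h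

section Visible

variable {A : Matrix (Fin n) (Fin n) ℝ} {B : Matrix (Fin n) (Fin m) ℝ} {x₀ : Fin n → ℝ}
  {P : Matrix (Fin n) (Fin k) ℝ} {Q : Matrix (Fin k) (Fin n) ℝ}

theorem mulVec_mulVec_eq_of_visible (hQ : Q * P = 1)
    (hV : LinearMap.range P.mulVecLin = visible A B x₀) : P.mulVec (Q.mulVec x₀) = x₀ := by
  have h := mul_compression_eq (Fintype.card_fin n).le hQ hV
  rw [mul_augment, mul_augment] at h
  ext i
  exact congrFun (congrFun h i) (Sum.inl ())

theorem mul_mul_eq_of_visible (hQ : Q * P = 1)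
    (hV : LinearMap.range P.mulVecLin = visible A B x₀) : P * (Q * B) = B := by
  have h := mul_compression_eq (Fintype.card_fin n).le hQ hV
  rw [mul_augment, mul_augment] at h
  ext i j
  exact congrFun (congrFun h i) (Sum.inr j)

theorem col_augment_zohB (A : Matrix (Fin k) (Fin k) ℝ) (B : Matrix (Fin n) (Fin m) ℝ)
    (x₀ : Fin n → ℝ) (t : ℝ) (c : Unit ⊕ Fin m) :
    (augment (Q.mulVec x₀) (zohB A (Q * B) t)).col c = (Q * augment x₀ B).col c ∨
      (augment (Q.mulVec x₀) (zohB A (Q * B) t)).col c =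
        (zohB A 1 t).mulVec ((Q * augment x₀ B).col c) := by
  rw [mul_augment]
  rcases c with c | c
  · exact .inl rfl
  · exact .inr (col_zohB _ _ _ c)

/-- The visible subspace is preserved by sampling at a non-pathological step. -/
theorem visible_zoh (A : Matrix (Fin n) (Fin n) ℝ) (B : Matrix (Fin n) (Fin m) ℝ)
    (x₀ : Fin n → ℝ) {t : ℝ} (ht : t ≠ 0) (h : NonPathologicalOn (fullSpectrum A) t) :
    visible (zohA A t) (zohB A B t) x₀ = visible A B x₀ := by
  obtain ⟨k, P, Q, hQ, hV⟩ := exists_coordinates (visible A B x₀)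
  refine krylov_zoh_eq (W' := augment (Q.mulVec x₀) (zohB (Q * A * P) (Q * B) t)) ht hQ hV
    (h.mono (compression_spectrum_subset hQ hV)) ?_ (col_augment_zohB _ _ _ _)
  rw [mul_augment, mul_zohB (mul_eq_mul_compression (Fintype.card_fin n).le hQ hV),
    mulVec_mulVec_eq_of_visible hQ hV, mul_mul_eq_of_visible hQ hV]

theorem mulVec_dtState_zoh (hQ : Q * P = 1)
    (hV : LinearMap.range P.mulVecLin = visible A B x₀) (t : ℝ) (u : ℕ → Fin m → ℝ) (j : ℕ) :
    Q.mulVec (dtState (zohA A t) (zohB A B t) x₀ u j) =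
      dtState (zohA (Q * A * P) t) (zohB (Q * A * P) (Q * B) t) (Q.mulVec x₀) u j := by
  have hAP := mul_eq_mul_compression (Fintype.card_fin n).le hQ hV
  have h := mulVec_dtState (zohA_mul hAP t) (zohB (Q * A * P) (Q * B) t) (Q.mulVec x₀) u j
  rw [mul_zohB hAP, mulVec_mulVec_eq_of_visible hQ hV, mul_mul_eq_of_visible hQ hV] at h
  rw [← h, Matrix.mulVec_mulVec, hQ, Matrix.one_mulVec]

end Visible

end ZOH

theorem mainTheorem8 {n m : ℕ} (A : Matrix (Fin n) (Fin n) ℝ) (B : Matrix (Fin n) (Fin m) ℝ)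
    (x₀ : Fin n → ℝ) (Δ : ℝ) (hΔ : 0 < Δ) :
    -- exact zero-order-hold dynamics
    (∀ (u : ℕ → Fin m → ℝ) (j : ℕ),
      ZOH.response A B x₀ (ZOH.hold Δ u) (j * Δ) =
        ZOH.dtState (ZOH.zohA A Δ) (ZOH.zohB A B Δ) x₀ u j) ∧
    -- the reachable subspace is preserved
    (ZOH.NonPathologicalOn (ZOH.reachableSpectrum A B) Δ →
      ZOH.reachable (ZOH.zohA A Δ) (ZOH.zohB A B Δ) = ZOH.reachable A B) ∧
    (ZOH.NonPathologicalOn (ZOH.fullSpectrum A) Δ →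
      -- both subspaces are preserved
      ZOH.reachable (ZOH.zohA A Δ) (ZOH.zohB A B Δ) = ZOH.reachable A B ∧
      ZOH.visible (ZOH.zohA A Δ) (ZOH.zohB A B Δ) x₀ = ZOH.visible A B x₀ ∧
      -- informativeness, in orthonormal coordinates of the visible subspace
      ∀ (k : ℕ) (P : Matrix (Fin n) (Fin k) ℝ),
        k = Module.finrank ℝ (ZOH.visible A B x₀) →
        ZOH.IsOrthonormalBasisOf P (ZOH.visible A B x₀) →
        -- the reduced pair with `[x₀ B]` is controllable
        ZOH.krylov k (ZOH.zohA (P.transpose * A * P) Δ)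
          (ZOH.augment (P.transpose.mulVec x₀)
            (ZOH.zohB (P.transpose * A * P) (P.transpose * B) Δ)) = ⊤ ∧
        ∀ (u : ℕ → Fin m → ℝ) (ξ : ℕ → Fin k → ℝ),
          (∀ j, ξ j = P.transpose.mulVec
            (ZOH.dtState (ZOH.zohA A Δ) (ZOH.zohB A B Δ) x₀ u j)) →
          -- the minimal coordinates follow the reduced zero-order-hold dynamics
          (∀ j, ξ (j + 1) = (ZOH.zohA (P.transpose * A * P) Δ).mulVec (ξ j) +
            (ZOH.zohB (P.transpose * A * P) (P.transpose * B) Δ).mulVec (u j)) ∧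
          -- a persistently exciting input of order `k + 1` gives a positive definite Gramian
          ∀ N : ℕ, ZOH.PersistentlyExciting (k + 1) N u → (ZOH.gramian ξ u N).PosDef) := by
  have ht := hΔ.ne'
  refine ⟨fun u j => ZOH.response_hold hΔ A B x₀ u j, ZOH.reachable_zoh ht, fun h =>
    ⟨ZOH.reachable_zoh ht (h.mono (ZOH.reachableSpectrum_subset A B)),
      ZOH.visible_zoh A B x₀ ht h, ?_⟩⟩
  rintro k P - ⟨hQ, hspan⟩
  have hV : LinearMap.range P.mulVecLin = ZOH.visible A B x₀ := by
    rw [Matrix.range_mulVecLin, hspan]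
  -- Orthonormality is the relation `Q * P = 1` for `Q = Pᵀ`, so the general compression results
  -- apply.
  have hc := ZOH.krylov_zoh_compression_eq_top ht hQ hV le_rfl
    (h.mono (ZOH.compression_spectrum_subset hQ hV)) (ZOH.col_augment_zohB _ B x₀ Δ)
  refine ⟨hc, fun u ξ hξ => ?_⟩
  obtain rfl := funext fun j => (hξ j).trans (ZOH.mulVec_dtState_zoh hQ hV Δ u j)
  exact ⟨fun j => rfl, fun N hN => ZOH.posDef_gramian fun η v hη =>
    ZOH.eq_zero_of_dotProduct_eq_zero hc hN hη⟩
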